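/- Let $\mathbb Z'=\mathbb Z+\tfrac12$ be the lattice of half-integers and let $0<\xi<1$. Let $z,z'\in\mathbb C$ be either in the principal series ($z,z'$ are not real and $z'=\bar z$) or in the complementary series ($z,z'$ are both real and lie in one open interval $(m,m+1)$ with $m\in\mathbb Z$). For $a,x\in\mathbb Z'$ set $$ \psi_a(x;z,z',\xi)=\left(\frac{\Gamma(x+z+\tfrac12)\,\Gamma(x+z'+\tfrac12)}{\Gamma(z-a+\tfrac12)\,\Gamma(z'-a+\tfrac12)}\right)^{1/2}\xi^{\frac12(x+a)}(1-\xi)^{\frac12(z+z')-a}\;\frac{F\!\left(-z+a+\tfrac12,\,-z'+a+\tfrac12;\,x+a+1;\,\tfrac{\xi}{\xi-1}\right)}{\Gamma(x+a+1)}, $$ where the expression under the root is positive and the positive square root is taken, $F(A,B;C;w)$ is the Gauss hypergeometric function (its principal branch on $\mathbb C\setminus[1,+\infty)$), and the ratio $F(A,B;C;w)/\Gamma(C)$, which makes sense for every $C\in\mathbb C$, is the analytic continuation from $|w|<1$ of $\sum_{n\ge0}\frac{(A)_n(B)_n}{\Gamma(C+n)\,n!}w^n$, with $1/\Gamma=0$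 at the poles of $\Gamma$. Then the functions $\psi_a=\psi_a(\,\cdot\,;z,z',\xi)$, $a\in\mathbb Z'$, are real-valued and form an orthonormal basis of the Hilbert space $\ell^2(\mathbb Z')$. -/

import Mathlib

/-- The value at `w` of the analytic continuation of the germ of `f` at `0` along the straight
segment `[0, w]`: the value `g w` of any function `g` that is analytic on a neighbourhood of the
segment and coincides with `f` near `0`.  By the identity theorem it does not depend on `g`, see
`radialContinuation_eq`.  (It is `0` by convention if there is no such `g`.) -/
noncomputable def radialContinuation (f : ℂ → ℂ) (w : ℂ) : ℂ :=
  open Classical in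
  if h : ∃ g : ℂ → ℂ, AnalyticOnNhd ℂ g (segment ℝ 0 w) ∧ g =ᶠ[nhds 0] f then
    h.choose w
  else 0

theorem radialContinuation_eq {f g : ℂ → ℂ} {w : ℂ}
    (hg : AnalyticOnNhd ℂ g (segment ℝ 0 w)) (hgf : g =ᶠ[nhds 0] f) :
    radialContinuation f w = g w := by
  have h : ∃ g : ℂ → ℂ, AnalyticOnNhd ℂ g (segment ℝ 0 w) ∧ g =ᶠ[nhds 0] f := ⟨g, hg, hgf⟩
  rw [radialContinuation, dif_pos h]
  exact h.choose_spec.1.eqOn_of_preconnected_of_eventuallyEq hg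
    (convex_segment (0 : ℂ) w).isPreconnected (left_mem_segment ℝ 0 w)
    (h.choose_spec.2.trans hgf.symm) (right_mem_segment ℝ 0 w)

/-- The ratio `F(A, B; C; w) / Γ(C)`, where `F` is (the principal branch on `ℂ ∖ [1, ∞)` of) the
Gauss hypergeometric function.  It is the analytic continuation from the unit disc of the power
series `∑ (A)ₙ (B)ₙ / (Γ(C + n) n!) wⁿ`, where `1 / Γ` vanishes at the poles of `Γ`, so that it
makes sense for every `C`.  As `ℂ ∖ [1, ∞)` is star-shaped around `0`, the continuation may be
carried out along segments. -/
noncomputable def gaussFDivGamma (A B C w : ℂ) : ℂ :=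
  radialContinuation (Complex.regularizedGaussHGFun A B C) w

/-- In the unit disc the continuation is the sum of the series itself. -/
theorem gaussFDivGamma_eq_of_norm_lt_one (A B C w : ℂ) (hw : ‖w‖ < 1) :
    gaussFDivGamma A B C w = Complex.regularizedGaussHGFun A B C w := by
  refine radialContinuation_eq ?_ Filter.EventuallyEq.rfl
  have hr := Complex.radius_regularizedGaussHGFunSeries_ge_one A B C
  have h := ((Complex.regularizedGaussHGFunSeries A B C).hasFPowerSeriesOnBall
    (lt_of_lt_of_le zero_lt_one hr)).analyticOnNhd
  refine h.mono fun y hy => ?_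
  have hy1 : y ∈ Metric.ball (0 : ℂ) 1 :=
    (convex_ball (0 : ℂ) 1).segment_subset (by simp) (by simpa using hw) hy
  refine Metric.eball_subset_eball hr ?_
  rw [← ENNReal.ofReal_one, Metric.eball_ofReal]
  exact hy1

/-- The lattice `ℤ' = ℤ + 1/2` of proper half-integers. -/
def HalfInt : Set ℝ := {x | ∃ n : ℤ, x = n + 1 / 2}

/-- The principal series: `z`, `z'` are not real and are conjugate to each other. -/
def IsPrincipalSeries (z z' : ℂ) : Prop :=
  z.im ≠ 0 ∧ z' = (starRingEnd ℂ) z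

/-- The complementary series: `z`, `z'` are real and lie in the same open interval `(m, m + 1)`
with `m ∈ ℤ`. -/
def IsComplementarySeries (z z' : ℂ) : Prop :=
  z.im = 0 ∧ z'.im = 0 ∧
    ∃ m : ℤ, z.re ∈ Set.Ioo (m : ℝ) (m + 1) ∧ z'.re ∈ Set.Ioo (m : ℝ) (m + 1)

/-- The function `ψ_a(x; z, z', ξ)`.  In the principal and the complementary series the ratio of
Gamma functions is a positive real number, and its principal complex power with exponent `1/2`
is the positive square root. -/
noncomputable def psi (z z' : ℂ) (ξ : ℝ) (a x : HalfInt) : ℂ :=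
  (Complex.Gamma ((x : ℝ) + z + 1 / 2) * Complex.Gamma ((x : ℝ) + z' + 1 / 2) /
      (Complex.Gamma (z - (a : ℝ) + 1 / 2) * Complex.Gamma (z' - (a : ℝ) + 1 / 2))) ^ (1 / 2 : ℂ) *
    (ξ : ℂ) ^ ((((x : ℝ) : ℂ) + (a : ℝ)) / 2) *
    (1 - ξ : ℂ) ^ ((z + z') / 2 - (a : ℝ)) *
    gaussFDivGamma (-z + (a : ℝ) + 1 / 2) (-z' + (a : ℝ) + 1 / 2) ((x : ℝ) + (a : ℝ) + 1)
      ((ξ : ℂ) / (ξ - 1))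

/-!
Let `s = √ξ`.  The Pfaff transformation (`gaussFDivGamma_eq`) turns the hypergeometric function at
`ξ / (ξ - 1)` into one at `ξ`, where its series converges:
`ψ_a(x)` is the square root of the quotient of the weights `Γ(z + n) Γ(z' + n)` for `n = x + 1/2` and
`n = 1/2 - a`, times `s ^ (x + a) * (1 - ξ) ^ ((z' - z + 1) / 2)`, times
`F(a - z + 1/2, x + z' + 1/2; x + a + 1; ξ) / Γ(x + a + 1)`
(`psi_halfIntEquiv`).  Three symmetries can be read off.  Interchanging `z` and `z'` does not change
`ψ_a` (`psi_swap`), so `ψ_a` equals its complex conjugate (`conj_psi`).  Since `F` is symmetric in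
its first two arguments, replacing `(z, z')` by `(-z, -z')` transposes the matrix `ψ_a(x)`
(`psi_neg`); the weights match by Euler's reflection formula.

Up to Gamma factors this function is the coefficient of `w ^ (x + a)` in the Laurent series of
`(1 - s w) ^ (-p) * (1 - s / w) ^ (-q)` on the unit circle, with `p = z' - a + 1/2` and
`q = a - z + 1/2` (`laurentCoeff_eq`).  Expand `ψ_a` in this way, and `ψ_b` in the same way with `z`
and `z'` interchanged.  In `∑ x, ψ_a(x) ψ_b(x)` the Gamma factors depending on `x` cancel the weights,
and what is left is a convolution of Laurent coefficients, that is, with `k = a - b`, the coefficient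
of `wᵏ` in `(1 - s w) ^ (k - 1) * (1 - s / w) ^ (-k - 1)`.  The parameters `z` and `z'` have dropped
out, and the coefficient vanishes for `k ≠ 0` for reasons of degree (`hasSum_laurentCoeff_mul`).  So
the `ψ_a` are orthonormal (`hasSum_psi_mul_psi`).

By transposition the columns of the matrix `ψ_a(x)` have norm one as well.  Hence Bessel's inequality
is an equality for each coordinate vector of `ℓ²`, and this forces the orthonormal family to be complete
(`inner_eq_zero_of_hasSum_norm_inner_sq`).
-/

/-! ### Coefficients of the binomial series -/

/-- The coefficient `(A)ₙ / n!` of `wⁿ` in the binomial series of `(1 - w) ^ (-A)`. -/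
noncomputable def binomCoeff {K : Type*} [Field K] (A : K) (n : ℕ) : K :=
  (ascPochhammer K n).eval A / n.factorial

@[simp]
theorem binomCoeff_zero {K : Type*} [Field K] (A : K) : binomCoeff A 0 = 1 := by
  simp [binomCoeff]

theorem binomCoeff_succ {K : Type*} [Field K] (A : K) (n : ℕ) :
    binomCoeff A (n + 1) = binomCoeff A n * ((A + n) / (n + 1)) := by
  simp only [binomCoeff, ascPochhammer_succ_eval, Nat.factorial_succ, Nat.cast_mul, Nat.cast_add,
    Nat.cast_one]
  rw [div_mul_div_comm, mul_comm ((n : K) + 1)]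

theorem binomCoeff_eq_multichoose (A : ℂ) (n : ℕ) : binomCoeff A n = Ring.multichoose A n := by
  have h := Ring.factorial_nsmul_multichoose_eq_ascPochhammer A n
  rw [Polynomial.ascPochhammer_smeval_eq_eval, nsmul_eq_mul] at h
  rw [binomCoeff, ← h, mul_div_cancel_left₀]
  exact_mod_cast n.factorial_ne_zero

/-- `(A)ₙ = 0` for a nonpositive integer `A > -n`. -/
theorem binomCoeff_neg_natCast (m n : ℕ) (h : m < n) : binomCoeff (-(m : ℂ)) n = 0 := by
  rw [binomCoeff, (ascPochhammer_eval_eq_zero_iff n (-(m : ℂ))).2 ⟨m, h, by simp⟩, zero_div]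

theorem binomCoeff_one (n : ℕ) : binomCoeff (1 : ℂ) n = 1 := by
  induction n with
  | zero => simp
  | succ n ih =>
    rw [binomCoeff_succ, ih, one_mul, add_comm, div_self]
    exact_mod_cast n.succ_ne_zero

/-- The Chu–Vandermonde identity: `(1 - w) ^ (-A) * (1 - w) ^ (-B) = (1 - w) ^ (-(A + B))`. -/
theorem sum_binomCoeff_mul (A B : ℂ) (n : ℕ) :
    ∑ p ∈ Finset.HasAntidiagonal.antidiagonal n, binomCoeff A p.1 * binomCoeff B p.2 =
      binomCoeff (A + B) n := by
  have key : ∀ (X : ℂ) (k : ℕ), binomCoeff X k = (-1) ^ k * Ring.choose (-X) k := by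
    intro X k
    rw [Ring.choose_neg', binomCoeff_eq_multichoose, Units.smul_def, Int.coe_negOnePow_natCast,
      zsmul_eq_mul, ← mul_assoc]
    push_cast
    rw [← mul_pow]
    simp
  rw [key, neg_add, Ring.add_choose_eq n (Commute.all _ _), Finset.mul_sum]
  refine Finset.sum_congr rfl fun p hp => ?_
  rw [key, key, ← Finset.HasAntidiagonal.mem_antidiagonal.1 hp, pow_add]
  ring

/-- Reversal of the Pochhammer symbol: `(-1)ⁿ (1 - A - n)ₙ = (A)ₙ`. -/
theorem binomCoeff_reverse (A : ℂ) (n : ℕ) :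
    (-1) ^ n * binomCoeff (1 - A - n) n = binomCoeff A n := by
  rw [binomCoeff_eq_multichoose, binomCoeff_eq_multichoose, Ring.multichoose_eq A]
  have h := Ring.choose_neg' (1 - A - n : ℂ) n
  rw [show -(1 - A - n : ℂ) = A + n - 1 by ring, Units.smul_def, Int.coe_negOnePow_natCast,
    zsmul_eq_mul] at h
  push_cast at h
  rw [h]

/-- The Pochhammer symbol shifts the argument of `1 / Γ`, the poles of `Γ` included. -/
theorem ascPochhammer_mul_inv_Gamma (C : ℂ) (n : ℕ) :
    (ascPochhammer ℂ n).eval C * (Complex.Gamma (C + n))⁻¹ = (Complex.Gamma C)⁻¹ := by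
  induction n with
  | zero => simp
  | succ n ih =>
    rw [← ih, Complex.one_div_Gamma_eq_self_mul_one_div_Gamma_add_one (C + n),
      ascPochhammer_succ_eval]
    push_cast
    rw [add_assoc C]
    ring

/-- The coefficient identity behind the Pfaff transformation. -/
theorem sum_neg_one_pow_binomCoeff_div_Gamma (C D : ℂ) (n : ℕ) :
    ∑ p ∈ Finset.HasAntidiagonal.antidiagonal n,
      (-1) ^ p.1 * binomCoeff D p.1 * (Complex.Gamma (C + p.1))⁻¹ / p.2.factorial =
      binomCoeff (C - D) n * (Complex.Gamma (C + n))⁻¹ := by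
  have h : ∀ p ∈ Finset.HasAntidiagonal.antidiagonal n,
      (-1) ^ p.1 * binomCoeff D p.1 * (Complex.Gamma (C + p.1))⁻¹ / p.2.factorial =
      (-1) ^ n * (binomCoeff D p.1 * binomCoeff (1 - C - n) p.2) * (Complex.Gamma (C + n))⁻¹ := by
    rintro ⟨k, m⟩ hp
    obtain rfl := Finset.HasAntidiagonal.mem_antidiagonal.1 hp
    have h1 := ascPochhammer_mul_inv_Gamma (C + k) m
    have h2 := binomCoeff_reverse (C + k) m
    rw [show 1 - (C + k) - m = 1 - C - ((k + m : ℕ) : ℂ) by push_cast; ring] at h2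
    have h3 : (ascPochhammer ℂ m).eval (C + k) = binomCoeff (C + k) m * m.factorial := by
      rw [binomCoeff, div_mul_cancel₀]
      exact_mod_cast m.factorial_ne_zero
    have h4 : (m.factorial : ℂ) ≠ 0 := by exact_mod_cast m.factorial_ne_zero
    simp only
    rw [← h1, h3, ← h2, pow_add, show C + (k : ℂ) + m = C + ((k + m : ℕ) : ℂ) by push_cast; ring]
    field_simp
  rw [Finset.sum_congr rfl h, ← Finset.sum_mul, ← Finset.mul_sum, sum_binomCoeff_mul,
    ← binomCoeff_reverse (C - D) n]
  congr 3
  ring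

theorem norm_ascPochhammer_eval_le (A : ℂ) (n : ℕ) :
    ‖(ascPochhammer ℂ n).eval A‖ ≤ (ascPochhammer ℝ n).eval ‖A‖ := by
  induction n with
  | zero => simp
  | succ n ih =>
    rw [ascPochhammer_succ_eval, ascPochhammer_succ_eval, norm_mul]
    refine mul_le_mul ih ((norm_add_le _ _).trans (by simp)) (norm_nonneg _)
      ((norm_nonneg _).trans ih)

theorem norm_binomCoeff_le (A : ℂ) (n : ℕ) : ‖binomCoeff A n‖ ≤ binomCoeff ‖A‖ n := by
  rw [binomCoeff, binomCoeff, norm_div, Complex.norm_natCast]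
  gcongr
  exact norm_ascPochhammer_eval_le A n

theorem ofReal_binomCoeff (A : ℝ) (n : ℕ) : ((binomCoeff A n : ℝ) : ℂ) = binomCoeff (A : ℂ) n := by
  induction n with
  | zero => simp
  | succ n ih => rw [binomCoeff_succ, binomCoeff_succ, ← ih]; push_cast; rfl

theorem binomCoeff_nonneg {A : ℝ} (hA : 0 ≤ A) (n : ℕ) : 0 ≤ binomCoeff A n := by
  induction n with
  | zero => simp
  | succ n ih => rw [binomCoeff_succ]; positivity

theorem binomCoeff_mono {A B : ℝ} (hA : 0 ≤ A) (hAB : A ≤ B) (n : ℕ) :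
    binomCoeff A n ≤ binomCoeff B n := by
  induction n with
  | zero => simp
  | succ n ih =>
    rw [binomCoeff_succ, binomCoeff_succ]
    exact mul_le_mul ih (by gcongr) (by positivity) (binomCoeff_nonneg (hA.trans hAB) n)

/-- The binomial series. -/
theorem hasSum_binomCoeff (A : ℂ) {w : ℂ} (hw : ‖w‖ < 1) :
    HasSum (fun n => binomCoeff A n * w ^ n) ((1 - w) ^ (-A)) := by
  have h := (Complex.one_div_one_sub_cpow_hasFPowerSeriesOnBall_zero A).hasSum (y := w)
    (by rw [← ENNReal.ofReal_one, Metric.eball_ofReal]; simpa using hw)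
  simp only [zero_add] at h
  rw [Complex.cpow_neg, ← one_div]
  convert! h using 2 with n
  simp [binomCoeff_eq_multichoose, Ring.multichoose_eq, FormalMultilinearSeries.ofScalars,
    mul_comm]

theorem hasSum_binomCoeff_real (A : ℝ) {w : ℝ} (h0 : 0 ≤ w) (hw : w < 1) :
    HasSum (fun n => binomCoeff A n * w ^ n) ((1 - w) ^ (-A)) := by
  have h := hasSum_binomCoeff (A : ℂ) (w := (w : ℂ)) (by simpa [abs_of_nonneg h0] using hw)
  rw [← Complex.hasSum_ofReal]
  convert! h using 1
  · ext n; push_cast; rw [ofReal_binomCoeff]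
  · rw [Complex.ofReal_cpow (by linarith)]; push_cast; rfl

theorem summable_norm_binomCoeff (A : ℂ) {w : ℂ} (hw : ‖w‖ < 1) :
    Summable fun n => ‖binomCoeff A n * w ^ n‖ := by
  refine (hasSum_binomCoeff_real ‖A‖ (norm_nonneg w) hw).summable.of_nonneg_of_le
    (fun n => norm_nonneg _) fun n => ?_
  rw [norm_mul, norm_pow]
  gcongr
  exact norm_binomCoeff_le A n

/-! ### The regularized Gauss hypergeometric series -/

/-- The coefficients of the regularized Gauss hypergeometric series. -/
noncomputable def gaussCoeff (A B C : ℂ) (n : ℕ) : ℂ :=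
  (ascPochhammer ℂ n).eval A * binomCoeff B n * (Complex.Gamma (C + n))⁻¹

theorem regularizedGaussHGFunSeries_apply (A B C w : ℂ) (n : ℕ) :
    (Complex.regularizedGaussHGFunSeries A B C n fun _ => w) = gaussCoeff A B C n * w ^ n := by
  rw [FormalMultilinearSeries.apply_eq_pow_smul_coeff, Complex.coeff_regularizedGaussHGFunSeries,
    gaussCoeff, binomCoeff, smul_eq_mul]
  field_simp

theorem mem_eball_radius (A B C : ℂ) {w : ℂ} (hw : ‖w‖ < 1) :
    w ∈ Metric.eball 0 (Complex.regularizedGaussHGFunSeries A B C).radius := by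
  refine Metric.eball_subset_eball (Complex.radius_regularizedGaussHGFunSeries_ge_one A B C) ?_
  rw [← ENNReal.ofReal_one, Metric.eball_ofReal]
  simpa using hw

theorem summable_norm_gaussCoeff (A B C : ℂ) {w : ℂ} (hw : ‖w‖ < 1) :
    Summable fun n => ‖gaussCoeff A B C n * w ^ n‖ := by
  have h := (Complex.regularizedGaussHGFunSeries A B C).summable_norm_apply
    (mem_eball_radius A B C hw)
  simpa only [regularizedGaussHGFunSeries_apply] using h

theorem regularizedGaussHGFun_eq_tsum (A B C w : ℂ) :
    Complex.regularizedGaussHGFun A B C w = ∑' n, gaussCoeff A B C n * w ^ n := by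
  simp only [← regularizedGaussHGFunSeries_apply]
  rfl

theorem analyticAt_regularizedGaussHGFun (A B C : ℂ) {w : ℂ} (hw : ‖w‖ < 1) :
    AnalyticAt ℂ (Complex.regularizedGaussHGFun A B C) w := by
  have hr := Complex.radius_regularizedGaussHGFunSeries_ge_one A B C
  exact ((Complex.regularizedGaussHGFunSeries A B C).hasFPowerSeriesOnBall
    (lt_of_lt_of_le zero_lt_one hr)).analyticOnNhd w (mem_eball_radius A B C hw)

/-- `(A)ₖ₊ⱼ = (A)ₖ (A + k)ⱼ`, divided by `j!`. -/
theorem ascPochhammer_mul_binomCoeff (A : ℂ) (k j : ℕ) :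
    (ascPochhammer ℂ k).eval A * binomCoeff (A + k) j =
      (ascPochhammer ℂ (k + j)).eval A / j.factorial := by
  rw [binomCoeff, ← ascPochhammer_mul, Polynomial.eval_mul, Polynomial.eval_comp, mul_div_assoc]
  simp

theorem conj_regularizedGaussHGFun (A B C w : ℂ) :
    (starRingEnd ℂ) (Complex.regularizedGaussHGFun A B C w) =
      Complex.regularizedGaussHGFun ((starRingEnd ℂ) A) ((starRingEnd ℂ) B) ((starRingEnd ℂ) C)
        ((starRingEnd ℂ) w) := by
  have hP (A : ℂ) (n : ℕ) : (starRingEnd ℂ) ((ascPochhammer ℂ n).eval A) =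
      (ascPochhammer ℂ n).eval ((starRingEnd ℂ) A) := by
    induction n with
    | zero => simp
    | succ n ih => rw [ascPochhammer_succ_eval, ascPochhammer_succ_eval, map_mul, ih]; simp
  rw [regularizedGaussHGFun_eq_tsum, regularizedGaussHGFun_eq_tsum, Complex.conj_tsum]
  refine tsum_congr fun n => ?_
  simp only [gaussCoeff, binomCoeff, map_mul, map_pow, map_inv₀, map_div₀, hP, map_natCast,
    ← Complex.Gamma_conj, map_add]

/-! ### The Pfaff transformation -/

theorem tsum_prod_eq_tsum_antidiagonal {f : ℕ × ℕ → ℂ} (hf : Summable f) :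
    ∑' p, f p = ∑' n, ∑ p ∈ Finset.HasAntidiagonal.antidiagonal n, f p := by
  rw [← Finset.HasAntidiagonal.sigmaAntidiagonalEquivProd.tsum_eq f]
  have h : Summable fun c => f (Finset.HasAntidiagonal.sigmaAntidiagonalEquivProd c) :=
    Finset.HasAntidiagonal.sigmaAntidiagonalEquivProd.summable_iff.2 hf
  rw [h.tsum_sigma' fun n => (hasSum_fintype _).summable]
  refine tsum_congr fun n => ?_
  rw [tsum_fintype]
  exact Finset.sum_coe_sort (Finset.HasAntidiagonal.antidiagonal n) f

/-- The double series obtained by expanding `(1 - w) ^ (-A) * F(A, D; C; w / (w - 1)) / Γ(C)` in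
powers of `w` converges absolutely for `|w| < 1/2`. -/
theorem summable_pfaff (A C D : ℂ) {w : ℂ} (hw : ‖w‖ < 1 / 2) :
    Summable fun p : ℕ × ℕ => gaussCoeff A D C p.1 * (-w) ^ p.1 *
      (binomCoeff (A + p.1) p.2 * w ^ p.2) := by
  have hw1 : ‖w‖ < 1 := hw.trans (by norm_num)
  have hpos : 0 < 1 - ‖w‖ := by linarith
  have hb (k : ℕ) : HasSum (fun j => ‖gaussCoeff A D C k * (-w) ^ k‖ *
      (binomCoeff (‖A‖ + k) j * ‖w‖ ^ j))
      (‖gaussCoeff A D C k * (-w) ^ k‖ * (1 - ‖w‖) ^ (-(‖A‖ + k))) :=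
    (hasSum_binomCoeff_real (‖A‖ + k) (norm_nonneg w) hw1).mul_left _
  have hsum : Summable fun p : ℕ × ℕ => ‖gaussCoeff A D C p.1 * (-w) ^ p.1‖ *
      (binomCoeff (‖A‖ + p.1) p.2 * ‖w‖ ^ p.2) := by
    have hnn (k j : ℕ) : 0 ≤ binomCoeff (‖A‖ + k) j := binomCoeff_nonneg (by positivity) j
    refine (summable_prod_of_nonneg fun p => ?_).2 ⟨fun k => (hb k).summable, ?_⟩
    · have := hnn p.1 p.2
      simp only [Pi.zero_apply]
      positivity
    · simp only [fun k => (hb k).tsum_eq]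
      have hq : ‖((‖w‖ / (1 - ‖w‖) : ℝ) : ℂ)‖ < 1 := by
        rw [Complex.norm_real, Real.norm_of_nonneg (by positivity), div_lt_one hpos]
        linarith
      refine ((summable_norm_gaussCoeff A D C hq).mul_left ((1 - ‖w‖) ^ (-‖A‖))).congr fun k => ?_
      rw [neg_add, Real.rpow_add hpos, Real.rpow_neg hpos.le (k : ℝ), Real.rpow_natCast,
        norm_mul, norm_mul, norm_pow, norm_pow, norm_neg, Complex.norm_real,
        Real.norm_of_nonneg (show 0 ≤ ‖w‖ / (1 - ‖w‖) by positivity), div_pow]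
      field_simp
  refine Summable.of_norm_bounded hsum fun p => ?_
  rw [norm_mul, norm_mul (binomCoeff _ _), norm_pow w]
  gcongr
  refine (norm_binomCoeff_le _ _).trans (binomCoeff_mono (norm_nonneg _) ?_ _)
  exact (norm_add_le _ _).trans (by simp)

/-- The Pfaff transformation near the origin. -/
theorem pfaff_of_norm_lt (A B C : ℂ) {w : ℂ} (hw : ‖w‖ < 1 / 2) :
    (1 - w) ^ (-A) * Complex.regularizedGaussHGFun A (C - B) C (w / (w - 1)) =
      Complex.regularizedGaussHGFun A B C w := by
  have hw1 : ‖w‖ < 1 := hw.trans (by norm_num)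
  have hne : 1 - w ≠ 0 := by
    rintro h
    rw [← sub_eq_zero.1 h] at hw1
    simp at hw1
  have hne' : w - 1 ≠ 0 := by rw [← neg_sub]; exact neg_ne_zero.2 hne
  have hs := summable_pfaff A C (C - B) hw
  calc (1 - w) ^ (-A) * Complex.regularizedGaussHGFun A (C - B) C (w / (w - 1))
      = ∑' k, ∑' j, gaussCoeff A (C - B) C k * (-w) ^ k * (binomCoeff (A + k) j * w ^ j) := by
        rw [regularizedGaussHGFun_eq_tsum, ← tsum_mul_left]
        refine tsum_congr fun k => ?_
        rw [tsum_mul_left, (hasSum_binomCoeff (A + k) hw1).tsum_eq, neg_add,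
          Complex.cpow_add _ _ hne, Complex.cpow_neg _ (k : ℂ), Complex.cpow_natCast,
          ← neg_div_neg_eq, neg_sub, div_pow]
        field_simp
    _ = ∑' p : ℕ × ℕ, gaussCoeff A (C - B) C p.1 * (-w) ^ p.1 *
          (binomCoeff (A + p.1) p.2 * w ^ p.2) := by rw [hs.tsum_prod]
    _ = Complex.regularizedGaussHGFun A B C w := by
        rw [tsum_prod_eq_tsum_antidiagonal hs, regularizedGaussHGFun_eq_tsum]
        refine tsum_congr fun n => ?_
        have h := sum_neg_one_pow_binomCoeff_div_Gamma C (C - B) n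
        rw [sub_sub_cancel] at h
        rw [gaussCoeff, mul_assoc _ (binomCoeff B n), ← h, Finset.mul_sum, Finset.sum_mul]
        refine Finset.sum_congr rfl fun p hp => ?_
        have hA := ascPochhammer_mul_binomCoeff A p.1 p.2
        rw [← Finset.HasAntidiagonal.mem_antidiagonal.1 hp, gaussCoeff, neg_pow w, pow_add]
        linear_combination (binomCoeff (C - B) p.1 * (Complex.Gamma (C + p.1))⁻¹ * (-1) ^ p.1 *
          w ^ p.1 * w ^ p.2) * hA

/-- The Pfaff transformation at the point `ξ / (ξ - 1)`, where the right-hand side is a convergent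
hypergeometric series.  The continuation runs along `[0, ξ / (ξ - 1)]`, which the map
`w ↦ w / (w - 1)` carries onto `[0, ξ]`. -/
theorem gaussFDivGamma_eq (A B C : ℂ) {ξ : ℝ} (hξ : ξ ∈ Set.Ioo (0 : ℝ) 1) :
    gaussFDivGamma A B C ((ξ : ℂ) / (ξ - 1)) =
      (1 - ξ : ℂ) ^ A * Complex.regularizedGaussHGFun A (C - B) C ξ := by
  obtain ⟨h0, h1⟩ := hξ
  have hpos : 0 < 1 - ξ := by linarith
  have hne : (ξ : ℂ) - 1 ≠ 0 := by
    rw [← Complex.ofReal_one, ← Complex.ofReal_sub, Complex.ofReal_ne_zero]; linarith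
  rw [gaussFDivGamma, radialContinuation_eq
    (g := fun w => (1 - w) ^ (-A) * Complex.regularizedGaussHGFun A (C - B) C (w / (w - 1)))]
  · have e1 : 1 - (ξ : ℂ) / (ξ - 1) = (((1 - ξ)⁻¹ : ℝ) : ℂ) := by
      push_cast
      have : (1 : ℂ) - ξ ≠ 0 := by rw [← neg_sub]; exact neg_ne_zero.2 hne
      field_simp
      ring
    have e2 : (ξ : ℂ) / (ξ - 1) / (ξ / (ξ - 1) - 1) = ξ := by
      field_simp
      ring_nf
    rw [e1, e2, Complex.ofReal_inv, Complex.inv_cpow, Complex.cpow_neg, inv_inv]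
    · push_cast; rfl
    · rw [Complex.arg_ofReal_of_nonneg hpos.le]
      exact Real.pi_pos.ne
  · intro y hy
    obtain ⟨t, ⟨ht0, ht1⟩, rfl⟩ : ∃ t ∈ Set.Icc (0 : ℝ) 1, t • ((ξ : ℂ) / (ξ - 1)) = y := by
      rw [segment_eq_image] at hy
      simpa using hy
    set r : ℝ := t * (ξ / (1 - ξ)) with hr
    have hr0 : 0 ≤ r := by positivity
    have hy' : t • ((ξ : ℂ) / (ξ - 1)) = ((-r : ℝ) : ℂ) := by
      rw [Complex.real_smul, hr, ← neg_sub (1 : ℂ), div_neg]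
      push_cast
      ring
    have hrξ : r / (1 + r) < 1 := by rw [div_lt_one (by positivity)]; linarith
    rw [hy']
    have hslit : 1 - ((-r : ℝ) : ℂ) ∈ Complex.slitPlane := by
      left
      simp
      linarith
    have hne2 : ((-r : ℝ) : ℂ) - 1 ≠ 0 := by
      rw [← neg_sub]; exact neg_ne_zero.2 (Complex.slitPlane_ne_zero hslit)
    refine AnalyticAt.mul ?_ ?_
    · exact (analyticAt_const.sub analyticAt_id).cpow analyticAt_const hslit
    · refine AnalyticAt.fun_comp (analyticAt_regularizedGaussHGFun _ _ _ ?_)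
        (analyticAt_id.div (analyticAt_id.sub analyticAt_const) hne2)
      have : ((-r : ℝ) : ℂ) / (((-r : ℝ) : ℂ) - 1) = ((r / (1 + r) : ℝ) : ℂ) := by
        rw [← neg_div_neg_eq]; push_cast; ring
      rw [this, Complex.norm_real, Real.norm_of_nonneg (by positivity)]
      exact hrξ
  · filter_upwards [Metric.ball_mem_nhds (0 : ℂ) (ε := 1 / 2) (by norm_num)] with w hw
    exact pfaff_of_norm_lt A B C (by simpa using hw)

/-! ### Laurent coefficients and biorthogonality -/

/-- The coefficient of `wⁿ` in the Laurent series `∑ i, f i * w ^ d i`. -/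
noncomputable def degreeCoeff {ι : Type*} (f : ι → ℂ) (d : ι → ℤ) (n : ℤ) : ℂ :=
  ∑' i, if d i = n then f i else 0

theorem summable_norm_ite {ι : Type*} {f : ι → ℂ} (hf : Summable fun i => ‖f i‖)
    (P : ι → Prop) [DecidablePred P] : Summable fun i => ‖if P i then f i else 0‖ := by
  refine hf.of_nonneg_of_le (fun _ => norm_nonneg _) fun i => ?_
  split_ifs <;> simp

/-- The coefficients of a product of absolutely convergent Laurent series are the convolution of
the coefficients of the factors. -/
theorem hasSum_degreeCoeff_mul {ι κ : Type*} {f : ι → ℂ} {g : κ → ℂ}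
    (hf : Summable fun i => ‖f i‖) (hg : Summable fun j => ‖g j‖) (d : ι → ℤ) (e : κ → ℤ) (k : ℤ) :
    HasSum (fun x => degreeCoeff f d x * degreeCoeff g e (k - x))
      (degreeCoeff (fun p : ι × κ => f p.1 * g p.2) (fun p => d p.1 + e p.2) k) := by
  have hfg : Summable fun p : ι × κ => ‖f p.1 * g p.2‖ := hf.mul_norm hg
  have h := (summable_norm_ite hfg fun p => d p.1 + e p.2 = k).of_norm.hasSum.tsum_fiberwise
    fun p => d p.1
  convert! h using 2 with x
  rw [degreeCoeff, degreeCoeff, tsum_mul_tsum_of_summable_norm (summable_norm_ite hf _)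
    (summable_norm_ite hg _),
    tsum_subtype _ fun p : ι × κ => if d p.1 + e p.2 = k then f p.1 * g p.2 else 0]
  refine tsum_congr fun p => ?_
  simp only [Set.indicator, Set.mem_preimage, Set.mem_singleton_iff]
  by_cases h1 : d p.1 = x
  · subst h1
    have : e p.2 = k - d p.1 ↔ d p.1 + e p.2 = k := by constructor <;> intro h <;> linarith
    simp [this]
  · simp [h1]

theorem degreeCoeff_equiv {ι κ : Type*} (σ : ι ≃ κ) (f : κ → ℂ) (d : κ → ℤ) (n : ℤ) :
    degreeCoeff (fun i => f (σ i)) (fun i => d (σ i)) n = degreeCoeff f d n :=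
  σ.tsum_eq fun i => if d i = n then f i else 0

/-- The coefficient of `wⁿ` in the Laurent expansion of `(1 - s w) ^ (-p) * (1 - s / w) ^ (-q)` on
the unit circle. -/
noncomputable def laurentCoeff (s p q : ℂ) : ℤ → ℂ :=
  degreeCoeff (fun i : ℕ × ℕ => binomCoeff p i.1 * s ^ i.1 * (binomCoeff q i.2 * s ^ i.2))
    fun i => (i.1 : ℤ) - i.2

/-- The substitution `w ↦ 1 / w` interchanges the two exponents. -/
theorem laurentCoeff_neg (s p q : ℂ) (n : ℤ) : laurentCoeff s p q (-n) = laurentCoeff s q p n := by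
  rw [laurentCoeff, laurentCoeff, ← degreeCoeff_equiv (Equiv.prodComm ℕ ℕ), degreeCoeff,
    degreeCoeff]
  refine tsum_congr fun i => ?_
  have : (i.1 : ℤ) - i.2 = n ↔ (i.2 : ℤ) - i.1 = -n := by constructor <;> intro h <;> linarith
  simp [this, mul_comm]

/-- The coefficients of `(1 - s w) ^ (-p) * (1 - s w) ^ (-p') = (1 - s w) ^ (-(p + p'))`, where the
monomial `wᵐ` is given the degree `d m`; the choice `d m = -m` turns `w` into `1 / w`. -/
theorem degreeCoeff_binomCoeff_mul {s : ℂ} (hs : ‖s‖ < 1) (p p' : ℂ) (d : ℕ → ℤ) (n : ℤ) :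
    degreeCoeff (fun i : ℕ × ℕ => binomCoeff p i.1 * s ^ i.1 * (binomCoeff p' i.2 * s ^ i.2))
      (fun i => d (i.1 + i.2)) n = ∑' m, if d m = n then binomCoeff (p + p') m * s ^ m else 0 := by
  have hsum := (summable_norm_binomCoeff p hs).mul_norm (summable_norm_binomCoeff p' hs)
  rw [degreeCoeff, tsum_prod_eq_tsum_antidiagonal (summable_norm_ite hsum _).of_norm]
  refine tsum_congr fun m => ?_
  rw [← sum_binomCoeff_mul, Finset.sum_mul]
  split_ifs with h
  · refine Finset.sum_congr rfl fun i hi => ?_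
    have hi := Finset.HasAntidiagonal.mem_antidiagonal.1 hi
    rw [hi, if_pos h, ← hi, pow_add]
    ring
  · refine Finset.sum_eq_zero fun i hi => ?_
    rw [Finset.HasAntidiagonal.mem_antidiagonal.1 hi, if_neg h]

/-- Biorthogonality.  The convolution is the coefficient of `wᵏ` in
`(1 - s w) ^ (k - 1) * (1 - s / w) ^ (-k - 1)`; for `k > 0` the first factor is a polynomial in `w`
of degree less than `k`, and for `k < 0` the second one is a polynomial in `1 / w` of degree less
than `-k`. -/
theorem hasSum_laurentCoeff_mul {s : ℂ} (hs : ‖s‖ < 1) {p q p' q' : ℂ} (k : ℤ)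
    (hp : p + p' = 1 - k) (hq : q + q' = 1 + k) :
    HasSum (fun x => laurentCoeff s p q x * laurentCoeff s p' q' (k - x))
      (if k = 0 then (1 - s ^ 2)⁻¹ else 0) := by
  have hb (r : ℂ) := summable_norm_binomCoeff r hs
  have h := hasSum_degreeCoeff_mul ((hb p).mul_norm (hb q)) ((hb p').mul_norm (hb q'))
    (fun i : ℕ × ℕ => (i.1 : ℤ) - i.2) (fun i : ℕ × ℕ => (i.1 : ℤ) - i.2) k
  have h' := hasSum_degreeCoeff_mul ((hb p).mul_norm (hb p')) ((hb q).mul_norm (hb q'))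
    (fun i : ℕ × ℕ => ((i.1 + i.2 : ℕ) : ℤ)) (fun i : ℕ × ℕ => -((i.1 + i.2 : ℕ) : ℤ)) k
  rw [← degreeCoeff_equiv (Equiv.prodProdProdComm ℕ ℕ ℕ ℕ)] at h'
  convert! h using 1
  trans ∑' x, degreeCoeff (fun i : ℕ × ℕ => binomCoeff p i.1 * s ^ i.1 *
      (binomCoeff p' i.2 * s ^ i.2)) (fun i => ((i.1 + i.2 : ℕ) : ℤ)) x *
    degreeCoeff (fun i : ℕ × ℕ => binomCoeff q i.1 * s ^ i.1 *
      (binomCoeff q' i.2 * s ^ i.2)) (fun i => -((i.1 + i.2 : ℕ) : ℤ)) (k - x)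
  swap
  · refine h'.tsum_eq.trans (tsum_congr fun i => ?_)
    have : (i.1.1 : ℤ) - i.1.2 + ((i.2.1 : ℤ) - i.2.2) =
        ((i.1.1 + i.2.1 : ℕ) : ℤ) + -((i.1.2 + i.2.2 : ℕ) : ℤ) := by push_cast; ring
    simp only [Equiv.prodProdProdComm_apply, this]
    congr 1
    ring
  symm
  simp only [degreeCoeff_binomCoeff_mul hs p p' (fun m => (m : ℤ)),
    degreeCoeff_binomCoeff_mul hs q q' (fun m => -(m : ℤ)), hp, hq]
  split_ifs with hk
  · subst hk
    simp only [Int.cast_zero, sub_zero, add_zero, binomCoeff_one, one_mul, zero_sub]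
    have hs2 : ‖s ^ 2‖ < 1 := by
      rw [norm_pow]; exact pow_lt_one₀ (norm_nonneg _) hs two_ne_zero
    rw [← tsum_geometric_of_norm_lt_one hs2]
    have hinj : Function.Injective ((↑) : ℕ → ℤ) := Nat.cast_injective
    rw [← hinj.tsum_eq]
    · refine tsum_congr fun m => ?_
      simp only [Nat.cast_inj, neg_inj, tsum_ite_eq]
      rw [← pow_mul, two_mul, pow_add]
    · intro x hx
      by_contra hneg
      refine hx ?_
      have : ∀ m : ℕ, (m : ℤ) ≠ x := fun m hm => hneg ⟨m, hm⟩
      simp [this]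
  · -- Every single term `(i, j)` of the convolution vanishes.
    rw [← tsum_zero (β := ℤ)]
    refine tsum_congr fun x => ?_
    rw [← tsum_mul_left]
    rw [← tsum_zero (β := ℕ)]
    refine tsum_congr fun j => ?_
    rw [← tsum_mul_right, ← tsum_zero (β := ℕ)]
    refine tsum_congr fun i => ?_
    split_ifs with h1 h2
    · rcases lt_or_gt_of_ne hk with hlt | hgt
      · obtain ⟨m, hm⟩ : ∃ m : ℕ, k = -(m + 1 : ℤ) := ⟨(-k - 1).toNat, by omega⟩
        have : binomCoeff (1 + k : ℂ) j = 0 := by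
          rw [hm, show (1 : ℂ) + ((-((m : ℤ) + 1) : ℤ) : ℂ) = -(m : ℂ) by push_cast; ring]
          exact binomCoeff_neg_natCast m j (by omega)
        rw [this]; ring
      · obtain ⟨m, hm⟩ : ∃ m : ℕ, k = (m + 1 : ℤ) := ⟨(k - 1).toNat, by omega⟩
        have : binomCoeff (1 - k : ℂ) i = 0 := by
          rw [hm, show (1 : ℂ) - (((m : ℤ) + 1 : ℤ) : ℂ) = -(m : ℂ) by push_cast; ring]
          exact binomCoeff_neg_natCast m i (by omega)
        rw [this]; ring
    all_goals simp

/-- `(p)ₘ / m!` for `m = n + j`, in terms of the `j`-th Pochhammer symbol of `p + n`. -/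
theorem binomCoeff_eq_Gamma_div {p : ℂ} (hp : ∀ m : ℤ, p ≠ m) {n : ℤ} {j m : ℕ} (hm : n + j = m) :
    binomCoeff p m = Complex.Gamma (p + n) / Complex.Gamma p *
      ((ascPochhammer ℂ j).eval (p + n) * (Complex.Gamma (n + 1 + j))⁻¹) := by
  have hGamma : ∀ m : ℤ, Complex.Gamma (p + m) ≠ 0 := fun m => Complex.Gamma_ne_zero fun l hl =>
    hp (-l - m) (by push_cast; linear_combination hl)
  have e1 := ascPochhammer_mul_inv_Gamma (p + n) j
  have e2 := ascPochhammer_mul_inv_Gamma p m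
  have e : (n : ℂ) + j = m := by exact_mod_cast congrArg (Int.cast : ℤ → ℂ) hm
  have hm1 : Complex.Gamma (p + m) ≠ 0 := by simpa using hGamma m
  have hn := hGamma n
  rw [add_assoc, e] at e1
  have e5 : (ascPochhammer ℂ m).eval p = Complex.Gamma (p + m) * (Complex.Gamma p)⁻¹ := by
    rw [← e2]
    field_simp
  have e6 : (ascPochhammer ℂ j).eval (p + n) =
      Complex.Gamma (p + m) * (Complex.Gamma (p + n))⁻¹ := by
    rw [← e1]
    field_simp
  rw [show (n : ℂ) + 1 + j = m + 1 by linear_combination e, Complex.Gamma_nat_eq_factorial, e6,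
    binomCoeff, e5]
  field_simp

theorem laurentCoeff_eq_tsum {s : ℂ} (hs : ‖s‖ < 1) (p q : ℂ) (n : ℤ) :
    laurentCoeff s p q n = ∑' j : ℕ, ∑' i : ℕ, if (i : ℤ) - j = n then
      binomCoeff p i * s ^ i * (binomCoeff q j * s ^ j) else 0 := by
  have hb (r : ℂ) := summable_norm_binomCoeff r hs
  have hsum := (summable_norm_ite ((hb p).mul_norm (hb q)) fun i => (i.1 : ℤ) - i.2 = n).of_norm
  rw [laurentCoeff, degreeCoeff, ← (Equiv.prodComm ℕ ℕ).tsum_eq]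
  exact hsum.prod_symm.tsum_prod

/-- The Laurent coefficients are hypergeometric functions of `s²`. -/
theorem laurentCoeff_eq {s : ℂ} (hs : ‖s‖ < 1) (hs0 : s ≠ 0) {p : ℂ} (hp : ∀ m : ℤ, p ≠ m) (q : ℂ)
    (n : ℤ) : laurentCoeff s p q n = s ^ n * (Complex.Gamma (p + n) / Complex.Gamma p) *
      Complex.regularizedGaussHGFun (p + n) q (n + 1) (s ^ 2) := by
  rw [laurentCoeff_eq_tsum hs, regularizedGaussHGFun_eq_tsum, ← tsum_mul_left]
  refine tsum_congr fun j => ?_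
  rcases le_or_gt 0 (n + j) with hnj | hnj
  · obtain ⟨m, hm⟩ := Int.eq_ofNat_of_zero_le hnj
    have hiff : ∀ i : ℕ, (i : ℤ) - j = n ↔ i = m := fun i => by omega
    simp only [hiff, tsum_ite_eq]
    have hpow : s ^ m * s ^ j = s ^ n * (s ^ 2) ^ j := by
      rw [← zpow_natCast s m, ← zpow_natCast s j, ← pow_mul, ← zpow_natCast s (2 * j),
        ← zpow_add₀ hs0, ← zpow_add₀ hs0]
      congr 1
      push_cast
      linarith [show (m : ℤ) = n + j from hm.symm]
    rw [gaussCoeff, binomCoeff_eq_Gamma_div hp hm]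
    generalize Complex.Gamma (p + n) / Complex.Gamma p = G
    generalize (Complex.Gamma (n + 1 + j))⁻¹ = H
    linear_combination (G * (ascPochhammer ℂ j).eval (p + n) * H * binomCoeff q j) * hpow
  · -- Here `n + 1 + j` is a pole of `Γ`, and there is no `i` with `i - j = n`.
    have hne : ∀ i : ℕ, (i : ℤ) - j ≠ n := fun i => by omega
    obtain ⟨l, hl⟩ : ∃ l : ℕ, n + 1 + j = -(l : ℤ) := ⟨(-(n + 1 + j)).toNat, by omega⟩
    have : (n : ℂ) + 1 + j = -(l : ℂ) := by exact_mod_cast congrArg (Int.cast : ℤ → ℂ) hl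
    simp [hne, gaussCoeff, this, Complex.Gamma_neg_nat_eq_zero]

/-! ### Gamma weights in the principal and complementary series -/

/-- The bijection `n ↦ n - 1/2` of `ℤ` onto the half-integers.  With `x = n - 1/2` and
`a = i - 1/2` the shifts `x + 1/2 = n`, `x + a + 1 = n + i` in `ψ_a(x)` are integers. -/
noncomputable def halfIntEquiv : ℤ ≃ HalfInt :=
  Equiv.ofBijective (fun n => ⟨(n : ℝ) - 1 / 2, n - 1, by push_cast; ring⟩) <| by
    constructor
    · intro m n h
      have := congrArg Subtype.val h
      simpa using this
    · rintro ⟨x, n, rfl⟩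
      refine ⟨n + 1, Subtype.ext ?_⟩
      push_cast
      ring

theorem coe_halfIntEquiv (n : ℤ) : (halfIntEquiv n : ℝ) = n - 1 / 2 := rfl

theorem series_swap {z z' : ℂ} (hz : IsPrincipalSeries z z' ∨ IsComplementarySeries z z') :
    IsPrincipalSeries z' z ∨ IsComplementarySeries z' z := by
  rcases hz with ⟨h, rfl⟩ | ⟨h, h', m, hm, hm'⟩
  · exact Or.inl ⟨by simpa using h, by simp⟩
  · exact Or.inr ⟨h', h, m, hm', hm⟩

theorem series_neg {z z' : ℂ} (hz : IsPrincipalSeries z z' ∨ IsComplementarySeries z z') :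
    IsPrincipalSeries (-z) (-z') ∨ IsComplementarySeries (-z) (-z') := by
  rcases hz with ⟨h, rfl⟩ | ⟨h, h', m, ⟨h1, h2⟩, h3, h4⟩
  · exact Or.inl ⟨by simpa using h, by simp⟩
  · refine Or.inr ⟨by simpa using h, by simpa using h', -m - 1, ⟨?_, ?_⟩, ?_, ?_⟩ <;>
      (simp only [Complex.neg_re]; push_cast; linarith)

theorem series_ne_int {z z' : ℂ} (hz : IsPrincipalSeries z z' ∨ IsComplementarySeries z z')
    (n : ℤ) : z ≠ n := by
  rintro rfl
  rcases hz with ⟨h, -⟩ | ⟨-, -, m, ⟨h1, h2⟩, -⟩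
  · simp at h
  · simp only [Complex.intCast_re] at h1 h2
    have h1 : m < n := by exact_mod_cast h1
    have h2 : n < m + 1 := by exact_mod_cast h2
    omega

theorem Gamma_add_int_ne_zero {z z' : ℂ}
    (hz : IsPrincipalSeries z z' ∨ IsComplementarySeries z z') (n : ℤ) :
    Complex.Gamma (z + n) ≠ 0 :=
  Complex.Gamma_ne_zero fun l hl => series_ne_int hz (-l - n) (by
    push_cast; linear_combination hl)

/-- `Γ` has constant sign between consecutive integers. -/
theorem Gamma_mul_Gamma_pos {r r' : ℝ} (m : ℤ) (hr : r ∈ Set.Ioo (m : ℝ) (m + 1))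
    (hr' : r' ∈ Set.Ioo (m : ℝ) (m + 1)) : 0 < Real.Gamma r * Real.Gamma r' := by
  have key : ∀ (k : ℕ) (r r' : ℝ), r ∈ Set.Ioo (-k : ℝ) (-k + 1) → r' ∈ Set.Ioo (-k : ℝ) (-k + 1) →
      0 < Real.Gamma r * Real.Gamma r' := by
    intro k
    induction k with
    | zero =>
      intro r r' hr hr'
      simp only [Nat.cast_zero, neg_zero] at hr hr'
      exact mul_pos (Real.Gamma_pos_of_pos hr.1) (Real.Gamma_pos_of_pos hr'.1)
    | succ k ih =>
      rintro r r' ⟨h1, h2⟩ ⟨h3, h4⟩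
      push_cast at h1 h2 h3 h4
      have hk : (0 : ℝ) ≤ k := k.cast_nonneg
      have hr : r < 0 := by linarith
      have hr' : r' < 0 := by linarith
      have h := ih (r + 1) (r' + 1) ⟨by linarith, by linarith⟩ ⟨by linarith, by linarith⟩
      rw [Real.Gamma_add_one hr.ne, Real.Gamma_add_one hr'.ne,
        show r * Real.Gamma r * (r' * Real.Gamma r') =
          (r * r') * (Real.Gamma r * Real.Gamma r') by ring] at h
      exact (pos_iff_pos_of_mul_pos h).1 (mul_pos_of_neg_of_neg hr hr')
  rcases le_or_gt 0 m with hm | hm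
  · have : (0 : ℝ) ≤ m := by exact_mod_cast hm
    exact mul_pos (Real.Gamma_pos_of_pos (this.trans_lt hr.1))
      (Real.Gamma_pos_of_pos (this.trans_lt hr'.1))
  · obtain ⟨k, rfl⟩ : ∃ k : ℕ, m = -(k : ℤ) := ⟨(-m).toNat, by omega⟩
    push_cast at hr hr'
    exact key k r r' hr hr'

/-- The weight `Γ(z + n) Γ(z' + n)`, which is real, and positive, in the two series. -/
noncomputable def gammaWeight (z z' : ℂ) (n : ℤ) : ℝ :=
  (Complex.Gamma (z + n) * Complex.Gamma (z' + n)).re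

theorem gammaWeight_spec {z z' : ℂ} (hz : IsPrincipalSeries z z' ∨ IsComplementarySeries z z')
    (n : ℤ) : 0 < gammaWeight z z' n ∧
      Complex.Gamma (z + n) * Complex.Gamma (z' + n) = (gammaWeight z z' n : ℂ) := by
  suffices ∃ P : ℝ, 0 < P ∧ Complex.Gamma (z + n) * Complex.Gamma (z' + n) = P by
    obtain ⟨P, hP, h⟩ := this
    rw [gammaWeight, h, Complex.ofReal_re]
    exact ⟨hP, rfl⟩
  have h0 := Gamma_add_int_ne_zero hz n
  rcases hz with ⟨h, rfl⟩ | ⟨h, h', m, hm, hm'⟩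
  · refine ⟨Complex.normSq (Complex.Gamma (z + n)), Complex.normSq_pos.2 h0, ?_⟩
    rw [← Complex.mul_conj, ← Complex.Gamma_conj]
    simp
  · refine ⟨Real.Gamma (z.re + n) * Real.Gamma (z'.re + n), ?_, ?_⟩
    · refine Gamma_mul_Gamma_pos (m + n) ⟨?_, ?_⟩ ⟨?_, ?_⟩ <;> push_cast
      · linarith [hm.1]
      · linarith [hm.2]
      · linarith [hm'.1]
      · linarith [hm'.2]
    · have e : z = (z.re : ℂ) := Complex.ext rfl (by simpa using h)
      have e' : z' = (z'.re : ℂ) := Complex.ext rfl (by simpa using h')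
      rw [Complex.ofReal_mul, ← Complex.Gamma_ofReal, ← Complex.Gamma_ofReal]
      push_cast
      rw [← e, ← e']

/-- Euler's reflection formula for the weights. -/
theorem gammaWeight_reflection {z z' : ℂ}
    (hz : IsPrincipalSeries z z' ∨ IsComplementarySeries z z') (m n : ℤ) :
    gammaWeight z z' m * gammaWeight (-z) (-z') (1 - m) =
      gammaWeight z z' n * gammaWeight (-z) (-z') (1 - n) := by
  have key : ∀ n : ℤ, ((gammaWeight z z' n * gammaWeight (-z) (-z') (1 - n) : ℝ) : ℂ) =
      Real.pi / Complex.sin (Real.pi * z) * (Real.pi / Complex.sin (Real.pi * z')) := by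
    intro n
    have hr : ∀ u : ℂ, Complex.Gamma (u + n) * Complex.Gamma (-u + (1 - n : ℤ)) =
        Real.pi / (((n.negOnePow : ℤ) : ℂ) * Complex.sin (Real.pi * u)) := by
      intro u
      have h := Complex.Gamma_mul_Gamma_one_sub (u + n)
      rw [show (Real.pi : ℂ) * (u + n) = Real.pi * u + n * Real.pi by ring,
        Complex.sin_antiperiodic.add_int_mul_eq] at h
      rw [← h]
      congr 2
      push_cast
      ring
    have hsq : ((n.negOnePow : ℤ) : ℂ) * ((n.negOnePow : ℤ) : ℂ) = 1 := by
      rw [← Int.cast_mul, ← Units.val_mul, Int.units_mul_self, Units.val_one, Int.cast_one]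
    rw [Complex.ofReal_mul, ← (gammaWeight_spec hz n).2, ← (gammaWeight_spec (series_neg hz) _).2]
    calc _ = (Complex.Gamma (z + n) * Complex.Gamma (-z + (1 - n : ℤ))) *
          (Complex.Gamma (z' + n) * Complex.Gamma (-z' + (1 - n : ℤ))) := by ring
      _ = _ := by
        rw [hr, hr, div_mul_div_comm, div_mul_div_comm, mul_mul_mul_comm, hsq, one_mul]
  exact_mod_cast (key m).trans (key n).symm

/-! ### The functions `ψ_a` and their symmetries -/

/-- The symmetry of `ψ_a` in `z` and `z'`, hidden in the convergent series of `psi_halfIntEquiv`. -/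
theorem psi_swap (z z' : ℂ) (ξ : ℝ) (a x : HalfInt) : psi z z' ξ a x = psi z' z ξ a x := by
  rw [psi, psi, mul_comm (Complex.Gamma ((x : ℝ) + z + 1 / 2)),
    mul_comm (Complex.Gamma (z - (a : ℝ) + 1 / 2)), add_comm z z', gaussFDivGamma, gaussFDivGamma,
    Complex.regularizedGaussHGFun_symm]

/-- The functions `ψ_a` through a convergent hypergeometric series. -/
theorem psi_halfIntEquiv {z z' : ℂ} {ξ : ℝ} (hξ : ξ ∈ Set.Ioo (0 : ℝ) 1)
    (hz : IsPrincipalSeries z z' ∨ IsComplementarySeries z z') (i n : ℤ) :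
    psi z z' ξ (halfIntEquiv i) (halfIntEquiv n) =
      (√(gammaWeight z z' n / gammaWeight z z' (1 - i)) : ℝ) * (√ξ : ℂ) ^ (n + i - 1) *
        (1 - ξ : ℂ) ^ ((z' - z + 1) / 2) *
        Complex.regularizedGaussHGFun (i - z) (n + z') (n + i) ξ := by
  have h1ξ : (1 - ξ : ℂ) ≠ 0 := by
    rw [← Complex.ofReal_one, ← Complex.ofReal_sub, Complex.ofReal_ne_zero]
    linarith [hξ.2]
  have hP := gammaWeight_spec hz n
  have hQ := gammaWeight_spec hz (1 - i)
  rw [psi, gaussFDivGamma_eq _ _ _ hξ, coe_halfIntEquiv, coe_halfIntEquiv]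
  have e1 : ((n - 1 / 2 : ℝ) : ℂ) + z + 1 / 2 = z + n := by push_cast; ring
  have e2 : ((n - 1 / 2 : ℝ) : ℂ) + z' + 1 / 2 = z' + n := by push_cast; ring
  have e3 : z - ((i - 1 / 2 : ℝ) : ℂ) + 1 / 2 = z + (1 - i : ℤ) := by push_cast; ring
  have e4 : z' - ((i - 1 / 2 : ℝ) : ℂ) + 1 / 2 = z' + (1 - i : ℤ) := by push_cast; ring
  have e5 : -z + ((i - 1 / 2 : ℝ) : ℂ) + 1 / 2 = i - z := by push_cast; ring
  have e6 : ((n - 1 / 2 : ℝ) : ℂ) + ((i - 1 / 2 : ℝ) : ℂ) + 1 = n + i := by push_cast; ring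
  have e7 : (n : ℂ) + i - (-z' + ((i - 1 / 2 : ℝ) : ℂ) + 1 / 2) = n + z' := by push_cast; ring
  have e8 : (((n - 1 / 2 : ℝ) : ℂ) + ((i - 1 / 2 : ℝ) : ℂ)) / 2 =
      ((1 / 2 * ((n + i - 1 : ℤ) : ℝ) : ℝ) : ℂ) := by push_cast; ring
  have e9 : (z' - z + 1) / 2 = (z + z') / 2 - ((i - 1 / 2 : ℝ) : ℂ) + (i - z) := by
    push_cast; ring
  have hroot : (((gammaWeight z z' n : ℂ) / gammaWeight z z' (1 - i)) ^ (1 / 2 : ℂ)) =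
      (√(gammaWeight z z' n / gammaWeight z z' (1 - i)) : ℝ) := by
    rw [Real.sqrt_eq_rpow, Complex.ofReal_cpow (div_pos hP.1 hQ.1).le]
    push_cast
    rfl
  have hpow : (ξ : ℂ) ^ ((1 / 2 * ((n + i - 1 : ℤ) : ℝ) : ℝ) : ℂ) = (√ξ : ℂ) ^ (n + i - 1) := by
    rw [← Complex.ofReal_cpow hξ.1.le, Real.rpow_mul hξ.1.le, ← Real.sqrt_eq_rpow,
      Real.rpow_intCast, Complex.ofReal_zpow]
  rw [e1, e2, e3, e4, e5, e6, e7, hP.2, hQ.2, hroot, e8, hpow, e9, Complex.cpow_add _ _ h1ξ]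
  ring

/-- Duality: the functions for `(-z, -z')` form the transposed matrix. -/
theorem psi_neg {z z' : ℂ} {ξ : ℝ} (hξ : ξ ∈ Set.Ioo (0 : ℝ) 1)
    (hz : IsPrincipalSeries z z' ∨ IsComplementarySeries z z') (a x : HalfInt) :
    psi (-z) (-z') ξ x a = psi z z' ξ a x := by
  obtain ⟨i, rfl⟩ := halfIntEquiv.surjective a
  obtain ⟨n, rfl⟩ := halfIntEquiv.surjective x
  rw [psi_swap, psi_halfIntEquiv hξ hz, psi_halfIntEquiv hξ (series_swap (series_neg hz)),
    Complex.regularizedGaussHGFun_symm]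
  have hw : gammaWeight (-z') (-z) i / gammaWeight (-z') (-z) (1 - n) =
      gammaWeight z z' n / gammaWeight z z' (1 - i) := by
    have hc : ∀ n, gammaWeight (-z') (-z) n = gammaWeight (-z) (-z') n := fun n => by
      rw [gammaWeight, gammaWeight, mul_comm]
    have h := gammaWeight_reflection hz n (1 - i)
    rw [sub_sub_cancel] at h
    rw [hc, hc, div_eq_div_iff (gammaWeight_spec (series_neg hz) _).1.ne'
      (gammaWeight_spec hz _).1.ne']
    linarith
  rw [hw, show i + n - 1 = n + i - 1 by ring, show -z - -z' + 1 = z' - z + 1 by ring,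
    show (i : ℂ) + -z = i - z by ring, show (n : ℂ) - -z' = n + z' by ring, add_comm (i : ℂ) n]

theorem conj_psi_eq {z z' : ℂ} {ξ : ℝ} (hξ : ξ ∈ Set.Ioo (0 : ℝ) 1)
    (hz : IsPrincipalSeries z z' ∨ IsComplementarySeries z z')
    (hz' : IsPrincipalSeries ((starRingEnd ℂ) z) ((starRingEnd ℂ) z') ∨
      IsComplementarySeries ((starRingEnd ℂ) z) ((starRingEnd ℂ) z')) (a x : HalfInt) :
    (starRingEnd ℂ) (psi z z' ξ a x) = psi ((starRingEnd ℂ) z) ((starRingEnd ℂ) z') ξ a x := by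
  obtain ⟨i, rfl⟩ := halfIntEquiv.surjective a
  obtain ⟨n, rfl⟩ := halfIntEquiv.surjective x
  have harg : (1 - ξ : ℂ).arg ≠ Real.pi := by
    rw [← Complex.ofReal_one, ← Complex.ofReal_sub,
      Complex.arg_ofReal_of_nonneg (by linarith [hξ.2])]
    exact Real.pi_pos.ne
  have hc := Complex.cpow_conj (1 - ξ : ℂ) ((z' - z + 1) / 2) harg
  have hw : ∀ m : ℤ, gammaWeight ((starRingEnd ℂ) z) ((starRingEnd ℂ) z') m =
      gammaWeight z z' m := by
    intro m
    have e : ∀ u : ℂ, Complex.Gamma ((starRingEnd ℂ) u + m) =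
        (starRingEnd ℂ) (Complex.Gamma (u + m)) := fun u => by rw [← Complex.Gamma_conj]; simp
    rw [gammaWeight, gammaWeight, e, e, ← map_mul, Complex.conj_re]
  rw [psi_halfIntEquiv hξ hz', psi_halfIntEquiv hξ hz, hw, hw]
  simp only [map_mul, Complex.conj_ofReal, map_zpow₀, conj_regularizedGaussHGFun, map_sub,
    map_add, map_intCast, map_one, map_div₀, map_ofNat] at hc ⊢
  rw [hc]

/-- The functions `ψ_a` are real-valued. -/
theorem conj_psi {z z' : ℂ} {ξ : ℝ} (hξ : ξ ∈ Set.Ioo (0 : ℝ) 1)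
    (hz : IsPrincipalSeries z z' ∨ IsComplementarySeries z z') (a x : HalfInt) :
    (starRingEnd ℂ) (psi z z' ξ a x) = psi z z' ξ a x := by
  rcases id hz with ⟨h, h'⟩ | ⟨h, h', -⟩
  · have e : (starRingEnd ℂ) z' = z := by rw [h']; simp
    rw [conj_psi_eq hξ hz (by rw [e, ← h']; exact series_swap hz), e, ← h', psi_swap]
  · have e := Complex.conj_eq_iff_im.2 h
    have e' := Complex.conj_eq_iff_im.2 h'
    rw [conj_psi_eq hξ hz (by rwa [e, e']), e, e']

/-! ### Orthonormality -/

theorem add_one_sub_ne_int {z z' : ℂ} (hz : IsPrincipalSeries z z' ∨ IsComplementarySeries z z')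
    (i m : ℤ) : z + (1 - i : ℤ) ≠ m := fun h =>
  series_ne_int hz (m - (1 - i)) (by push_cast at h ⊢; linear_combination h)

/-- A product of two of the functions is, up to a factor that does not depend on the argument, a
product of Laurent coefficients.  The first function is expanded as it stands, the second one with
`z` and `z'` interchanged. -/
theorem psi_mul_psi {z z' : ℂ} {ξ : ℝ} (hξ : ξ ∈ Set.Ioo (0 : ℝ) 1)
    (hz : IsPrincipalSeries z z' ∨ IsComplementarySeries z z') (i j n : ℤ) :
    psi z z' ξ (halfIntEquiv i) (halfIntEquiv n) * psi z z' ξ (halfIntEquiv j) (halfIntEquiv n) =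
      (1 - ξ) / (√(gammaWeight z z' (1 - i)) * √(gammaWeight z z' (1 - j)) : ℝ) *
        (Complex.Gamma (z' + (1 - i : ℤ)) * Complex.Gamma (z + (1 - j : ℤ))) *
        (laurentCoeff √ξ (z' + (1 - i : ℤ)) (i - z) (n + (i - 1)) *
          laurentCoeff √ξ (j - z') (z + (1 - j : ℤ)) (i - j - (n + (i - 1)))) := by
  have hz' := series_swap hz
  have hs : ‖(√ξ : ℂ)‖ < 1 := by
    rw [Complex.norm_real, Real.norm_of_nonneg (Real.sqrt_nonneg _), Real.sqrt_lt' one_pos]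
    simpa using hξ.2
  have hs0 : (√ξ : ℂ) ≠ 0 := by
    rw [Complex.ofReal_ne_zero]
    exact (Real.sqrt_pos.2 hξ.1).ne'
  have hs2 : (√ξ : ℂ) ^ 2 = ξ := by rw [← Complex.ofReal_pow, Real.sq_sqrt hξ.1.le]
  have h1ξ : (1 - ξ : ℂ) ≠ 0 := by
    rw [← Complex.ofReal_one, ← Complex.ofReal_sub, Complex.ofReal_ne_zero]
    linarith [hξ.2]
  rw [show i - j - (n + (i - 1)) = -(n + (j - 1)) by ring, laurentCoeff_neg,
    laurentCoeff_eq hs hs0 (add_one_sub_ne_int hz' i), laurentCoeff_eq hs hs0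
    (add_one_sub_ne_int hz j), hs2, psi_swap z z' ξ (halfIntEquiv j), psi_halfIntEquiv hξ hz,
    psi_halfIntEquiv hξ hz']
  have e1 (u : ℂ) (k : ℤ) : u + (1 - k : ℤ) + (n + (k - 1) : ℤ) = n + u := by push_cast; ring
  have e2 (k : ℤ) : ((n + (k - 1) : ℤ) : ℂ) + 1 = n + k := by push_cast; ring
  rw [e1, e1, e2, e2, Complex.regularizedGaussHGFun_symm (n + z'),
    Complex.regularizedGaussHGFun_symm (n + z)]
  have hc (k : ℤ) : gammaWeight z' z k = gammaWeight z z' k := by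
    rw [gammaWeight, gammaWeight, mul_comm]
  have hpow : (1 - ξ : ℂ) ^ ((z' - z + 1) / 2) * (1 - ξ : ℂ) ^ ((z - z' + 1) / 2) = 1 - ξ := by
    rw [← Complex.cpow_add _ _ h1ξ, show (z' - z + 1) / 2 + (z - z' + 1) / 2 = 1 by ring,
      Complex.cpow_one]
  obtain ⟨hP, hP'⟩ := gammaWeight_spec hz n
  have hPi := (gammaWeight_spec hz (1 - i)).1
  have hPj := (gammaWeight_spec hz (1 - j)).1
  have hG := Gamma_add_int_ne_zero hz' (1 - i)
  have hG' := Gamma_add_int_ne_zero hz (1 - j)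
  have hroot : ((√(gammaWeight z z' n / gammaWeight z z' (1 - i)) : ℝ) : ℂ) *
      (√(gammaWeight z z' n / gammaWeight z z' (1 - j)) : ℝ) =
      (Complex.Gamma (n + z) * Complex.Gamma (n + z')) /
        (√(gammaWeight z z' (1 - i)) * √(gammaWeight z z' (1 - j)) : ℝ) := by
    rw [add_comm (n : ℂ) z, add_comm (n : ℂ) z', hP', ← Complex.ofReal_mul, ← Complex.ofReal_div,
      Real.sqrt_div hP.le, Real.sqrt_div hP.le, div_mul_div_comm, Real.mul_self_sqrt hP.le]
  rw [hc, hc, add_sub_assoc, add_sub_assoc]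
  generalize Complex.regularizedGaussHGFun _ _ _ _ = F
  generalize Complex.regularizedGaussHGFun _ _ _ _ = F'
  generalize (1 - ξ : ℂ) ^ ((z' - z + 1) / 2) = c at *
  generalize (1 - ξ : ℂ) ^ ((z - z' + 1) / 2) = c' at *
  generalize ((√(gammaWeight z z' n / gammaWeight z z' (1 - i)) : ℝ) : ℂ) = r at *
  generalize ((√(gammaWeight z z' n / gammaWeight z z' (1 - j)) : ℝ) : ℂ) = r' at *
  generalize (√ξ : ℂ) ^ (n + (i - 1)) = t
  generalize (√ξ : ℂ) ^ (n + (j - 1)) = t'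
  calc r * t * c * F * (r' * t' * c' * F') = (r * r') * (c * c') * (t * t' * F * F') := by ring
    _ = _ := by
      rw [hroot, hpow]
      field_simp

/-- The functions `ψ_a` are orthonormal. -/
theorem hasSum_psi_mul_psi {z z' : ℂ} {ξ : ℝ} (hξ : ξ ∈ Set.Ioo (0 : ℝ) 1)
    (hz : IsPrincipalSeries z z' ∨ IsComplementarySeries z z') (a b : HalfInt) [Decidable (a = b)] :
    HasSum (fun x => psi z z' ξ a x * psi z z' ξ b x) (if a = b then 1 else 0) := by
  obtain ⟨i, rfl⟩ := halfIntEquiv.surjective a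
  obtain ⟨j, rfl⟩ := halfIntEquiv.surjective b
  have hs : ‖(√ξ : ℂ)‖ < 1 := by
    rw [Complex.norm_real, Real.norm_of_nonneg (Real.sqrt_nonneg _), Real.sqrt_lt' one_pos]
    simpa using hξ.2
  rw [← halfIntEquiv.hasSum_iff]
  have h := hasSum_laurentCoeff_mul hs (p := z' + (1 - i : ℤ)) (q := i - z) (p' := j - z')
    (q' := z + (1 - j : ℤ)) (i - j) (by push_cast; ring) (by push_cast; ring)
  rw [← (Equiv.addRight (i - 1)).hasSum_iff] at h
  convert! h.mul_left ((1 - ξ) / (√(gammaWeight z z' (1 - i)) * √(gammaWeight z z' (1 - j)) : ℝ) *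
    (Complex.Gamma (z' + (1 - i : ℤ)) * Complex.Gamma (z + (1 - j : ℤ)))) using 1
  · ext n
    exact psi_mul_psi hξ hz i j n
  · by_cases hij : i = j
    · subst hij
      have hP := gammaWeight_spec hz (1 - i)
      have h1ξ : (1 - ξ : ℂ) ≠ 0 := by
        rw [← Complex.ofReal_one, ← Complex.ofReal_sub, Complex.ofReal_ne_zero]
        linarith [hξ.2]
      have hne : (gammaWeight z z' (1 - i) : ℂ) ≠ 0 := Complex.ofReal_ne_zero.2 hP.1.ne'
      rw [if_pos rfl, if_pos (sub_self i), Real.mul_self_sqrt hP.1.le, mul_comm (Complex.Gamma _), hP.2,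
        ← Complex.ofReal_pow, Real.sq_sqrt hξ.1.le]
      field_simp
    · rw [if_neg (sub_ne_zero.2 hij), if_neg (halfIntEquiv.injective.ne hij), mul_zero]

/-! ### Completeness -/

/-- If Bessel's inequality for `e` is an equality, then `e` is orthogonal to every vector that is
orthogonal to the given orthonormal family. -/
theorem inner_eq_zero_of_hasSum_norm_inner_sq {E ι : Type*} [NormedAddCommGroup E]
    [InnerProductSpace ℂ E] {v : ι → E} (hv : Orthonormal ℂ v) {e h : E}
    (he : HasSum (fun a => ‖inner ℂ (v a) e‖ ^ 2) (‖e‖ ^ 2)) (hh : ∀ a, inner ℂ (v a) h = 0) :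
    inner ℂ e h = 0 := by
  by_contra hne
  set c : ℂ := inner ℂ h e with hc
  have hceq : inner ℂ e h = (starRingEnd ℂ) c := (inner_conj_symm e h).symm
  have hcpos : 0 < ‖c‖ ^ 2 := by
    have : c ≠ 0 := fun h0 => hne (by rw [hceq, h0, map_zero])
    positivity
  -- Bessel's inequality for `e - (ε c) h` has the same left-hand side as for `e`.
  set ε : ℝ := 1 / (‖h‖ ^ 2 + 1) with hε
  have hεpos : 0 < ε := by positivity
  have hB := hv.tsum_inner_products_le (e - ((ε : ℂ) * c) • h)
  simp only [inner_sub_right, inner_smul_right, hh, mul_zero, sub_zero, he.tsum_eq] at hB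
  rw [norm_sub_sq (𝕜 := ℂ), inner_smul_right, hceq, mul_assoc, Complex.mul_conj,
    Complex.normSq_eq_norm_sq, ← Complex.ofReal_mul, norm_smul, norm_mul, Complex.norm_real,
    Real.norm_of_nonneg hεpos.le] at hB
  have hre : RCLike.re (((ε * ‖c‖ ^ 2 : ℝ) : ℂ)) = ε * ‖c‖ ^ 2 := Complex.ofReal_re _
  rw [hre] at hB
  have h1 : ε * ‖h‖ ^ 2 ≤ 1 := by
    rw [hε, one_div_mul_eq_div, div_le_one (by positivity)]
    linarith
  nlinarith [mul_pos hεpos hcpos, mul_le_mul_of_nonneg_left h1 (mul_pos hεpos hcpos).le]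

theorem proposition2p4 (z z' : ℂ) (ξ : ℝ) (hξ : ξ ∈ Set.Ioo (0 : ℝ) 1)
    (hz : IsPrincipalSeries z z' ∨ IsComplementarySeries z z') :
    (∀ a x : HalfInt, (psi z z' ξ a x).im = 0) ∧
    ∃ b : HilbertBasis HalfInt ℂ (lp (fun _ : HalfInt => ℂ) 2),
      ∀ a x : HalfInt, b a x = psi z z' ξ a x := by
  classical
  have hconj := conj_psi hξ hz
  refine ⟨fun a x => Complex.conj_eq_iff_im.1 (hconj a x), ?_⟩
  have hsq (a x : HalfInt) : psi z z' ξ a x * psi z z' ξ a x = ((‖psi z z' ξ a x‖ ^ 2 : ℝ) : ℂ) := by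
    rw [← Complex.normSq_eq_norm_sq, ← Complex.mul_conj, hconj]
  have hmem (a : HalfInt) : Memℓp (fun x => psi z z' ξ a x) 2 := by
    have h := (hasSum_psi_mul_psi hξ hz a a).summable
    simp only [hsq] at h
    refine memℓp_gen ((Complex.summable_ofReal.1 h).congr fun x => ?_)
    norm_num
  let v : HalfInt → lp (fun _ : HalfInt => ℂ) 2 := fun a => ⟨fun x => psi z z' ξ a x, hmem a⟩
  have hv : Orthonormal ℂ v := by
    rw [orthonormal_iff_ite]
    intro a b
    refine (lp.hasSum_inner (v a) (v b)).unique ?_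
    convert! hasSum_psi_mul_psi hξ hz a b using 2 with x
    change psi z z' ξ b x * (starRingEnd ℂ) (psi z z' ξ a x) = _
    rw [hconj, mul_comm]
  refine ⟨HilbertBasis.mkOfOrthogonalEqBot hv ?_, fun a x => by
    rw [HilbertBasis.coe_mkOfOrthogonalEqBot]⟩
  refine (Submodule.eq_bot_iff _).2 fun h hh => lp.ext (funext fun x => ?_)
  have hin : inner ℂ (lp.single 2 x (1 : ℂ)) h = h x := by
    rw [lp.inner_single_left]
    simp
  rw [← hin]
  refine inner_eq_zero_of_hasSum_norm_inner_sq hv ?_ fun a =>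
    (Submodule.mem_orthogonal _ _).1 hh (v a) (Submodule.subset_span ⟨a, rfl⟩)
  -- The columns of the matrix `ψ_a(x)` have norm one: they are the functions for `(-z, -z')`.
  have hcol := hasSum_psi_mul_psi hξ (series_neg hz) x x
  simp only [psi_neg hξ hz, hsq, if_true] at hcol
  rw [lp.norm_single (by norm_num), norm_one, one_pow]
  rw [← Complex.hasSum_ofReal]
  convert! hcol using 1
  ext a
  rw [lp.inner_single_right]
  simp [v]
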